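/- Fix a support size $k\ge 2$. For a distribution $\mathbf p=(p_1,\dots,p_k)$ on $[k]$ let $C(\mathbf p)=\sum_i p_i^2$ be its collision probability. A mechanism with $n$ users is an interactive protocol between a server and $n$ users, user $i$ holding one private sample $x_i\in[k]$. The number of messages is finite, and every message becomes part of the transcript. Who sends the next message is determined by the transcript so far; a message of the server is random with a law depending only on the transcript so far, and a message of user $i$ is random with a law depending only on the transcript so far and on $x_i$ (messages take values in a standard Borel space). The mechanism $M$ is $(\alpha,0)$-locally differentially private if, for all samples $x_1,\dots,x_n$, every user $i$, every $x_i'$ and every measurable set $\mathcal O$ of transcripts, $$\Pr[M(x_1,\dots,x_n)\in\mathcal O]\le e^{\alpha}\,\Pr[M(x_1,\dots,x_{i-1},x_i',x_{i+1},\dots,x_n)\in\mathcal O].$$ Theorem. For every $\theta\in(0,1)$ there is a constant $c>0$, depending only on $\theta$, such that the following holds. Let $k\ge 2$, $n\ge 0$, $0\le\alpha\le\frac{23}{35}$, $0<\varepsilon\le\frac{\theta}{2}\left(1-\frac1k\right)$ and $n\,\alpha^2\varepsilon^2\le c$ (for $\alpha>0$: $n\le \frac{c}{\alpha^2\varepsilon^2}$).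 Let $\hat C_{\alpha,n}(\mathbf p)$ be any real-valued measurable function of the transcript of an $(\alpha,0)$-locally differentially private mechanism with $n$ users whose samples are drawn independently from $\mathbf p$. Then there is a distribution $\mathbf p$ on $[k]$ such that $$\mathbb E\left[\,\left|\hat C_{\alpha,n}(\mathbf p)-C(\mathbf p)\right|\,\right]\ge\varepsilon .$$ In particular, if along a sequence of parameters with $\varepsilon\le\frac{\theta}{2}\left(1-\frac1k\right)$ one has $n=o\left(\frac{1}{\alpha^2\varepsilon^2}\right)$, then eventually the expected error is at least $\varepsilon$ on some distribution. -/

import Mathlib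

open MeasureTheory ProbabilityTheory

/-- A (fully interactive) communication protocol between a server and `n` users, where user `i`
holds a single private sample in `Fin k`. Messages take values in the measurable space `Y`, and
everything that is sent becomes part of the transcript. In round `t` the messages sent so far,
`h : Fin t → Y`, determine who speaks: the server (`none`) or a user (`some i`). The server's
message is random with a law that depends only on `h`; the message of user `i` is random with a law
that depends only on `h` and on the sample of user `i`. The fresh randomness used in different
rounds is independent. Non-interactive mechanisms, with or without a public random string sent by
the server, are the special case in which every user speaks once and the law of the message ignores
the messages of the other users. -/
structure LocalProtocol (n k : ℕ) (Y : Type*) [MeasurableSpace Y] where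
  /-- the number of messages sent -/
  rounds : ℕ
  /-- who sends the message number `t`, given the previous messages -/
  speaker : (t : ℕ) → (Fin t → Y) → Option (Fin n)
  measurableSet_speaker : ∀ t o, MeasurableSet {h : Fin t → Y | speaker t h = o}
  /-- the law of the message of the server, given the previous messages -/
  server : (t : ℕ) → Kernel (Fin t → Y) Y
  isMarkovKernel_server : ∀ t, IsMarkovKernel (server t)
  /-- the law of the message of user `i`, given the user's sample and the previous messages -/
  user : Fin n → (t : ℕ) → Fin k → Kernel (Fin t → Y) Y
  isMarkovKernel_user : ∀ i t a, IsMarkovKernel (user i t a)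

namespace LocalProtocol

variable {n k : ℕ} {Y : Type*} [MeasurableSpace Y]

/-- The law of message number `t` given the previous messages, when the samples of the users are
`x`. -/
noncomputable def step (P : LocalProtocol n k Y) (x : Fin n → Fin k) (t : ℕ) :
    Kernel (Fin t → Y) Y where
  toFun h := match P.speaker t h with
    | none => P.server t h
    | some i => P.user i t (x i) h
  measurable' := by
    let _ : MeasurableSpace (Option (Fin n)) := ⊤
    have hs : Measurable (P.speaker t) :=
      measurable_to_countable' fun o => P.measurableSet_speaker t o
    have hg : Measurable fun q : Option (Fin n) × (Fin t → Y) =>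
        (match q.1 with
          | none => P.server t q.2
          | some i => P.user i t (x i) q.2 : Measure Y) := by
      refine measurable_from_prod_countable_right fun o => ?_
      cases o with
      | none => exact (P.server t).measurable
      | some i => exact (P.user i t (x i)).measurable
    exact hg.comp (hs.prodMk measurable_id)

/-- The law of the first `t` messages when the samples of the users are `x`. -/
noncomputable def prefixLaw (P : LocalProtocol n k Y) (x : Fin n → Fin k) :
    (t : ℕ) → Measure (Fin t → Y)
  | 0 => Measure.dirac Fin.elim0
  | t + 1 => (prefixLaw P x t ⊗ₘ P.step x t).map
      fun q => (Fin.snoc q.1 q.2 : Fin (t + 1) → Y)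

/-- The law of the whole transcript when the samples of the users are `x`. -/
noncomputable def transcriptLaw (P : LocalProtocol n k Y) (x : Fin n → Fin k) :
    Measure (Fin P.rounds → Y) :=
  P.prefixLaw x P.rounds

/-- `(α, β)`-local differential privacy: changing the sample of a single user changes the
probability of any event about the transcript by at most a factor `e ^ α` and an additive `β`. -/
def IsLDP (P : LocalProtocol n k Y) (α β : ℝ) : Prop :=
  ∀ (x : Fin n → Fin k) (i : Fin n) (a : Fin k) (O : Set (Fin P.rounds → Y)), MeasurableSet O →
    P.transcriptLaw x O ≤
      ENNReal.ofReal (Real.exp α) * P.transcriptLaw (Function.update x i a) O + ENNReal.ofReal β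

end LocalProtocol

/-- The collision probability of the distribution `p`. -/
def collisionProb {k : ℕ} (p : Fin k → ℝ) : ℝ := ∑ a, p a ^ 2

/-- The expected absolute error `E |Ĉ - C(p)|` of the estimate `Ĉ` of the collision probability that
is computed from the transcript, when the users draw their samples independently from `p`. It takes
values in `[0, ∞]`. -/
noncomputable def expectedError {n k : ℕ} {Y : Type*} [MeasurableSpace Y]
    (P : LocalProtocol n k Y) (est : (Fin P.rounds → Y) → ℝ) (p : Fin k → ℝ) : ENNReal :=
  ∑ x : Fin n → Fin k, ENNReal.ofReal (∏ i, p (x i)) *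
    ∫⁻ h, ENNReal.ofReal |est h - collisionProb p| ∂(P.transcriptLaw x)

/-! This is Le Cam's method with a point mass at `a₀` and a mixture `q` of it with the uniform law.
Near a vertex of the simplex the collision probability changes linearly: a gap `γ` costs only `1 - q
a₀ ≤ γ`.

Transcript densities factor over users (`exists_prefixLaw_density`), and privacy bounds each user's
likelihood ratio relative to `a₀` (`IsLDP.exists_likelihoodRatio`). Averaging over `q` gives the
transcript likelihood ratio `∏ i, r i` with `|r i - 1| ≤ γ (e ^ α - 1)`. Under the point mass all
samples are fixed, and each `r i` has mean 1 because changing one sample again gives a transcript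
law. Hence the linear terms of `∑ i, log (r i)` integrate to zero without any independence, the
divergence is of order `n α² γ²`, and interaction gains nothing. For `γ = 2ε/θ` the affinity is at
least `θ`, so the two errors sum to at least `θγ = 2ε`. -/

namespace MeasureTheory.Measure

/-- Densities multiply when a measure is extended by a kernel. -/
theorem map_withDensity_compProd {A B C : Type*} [MeasurableSpace A] [MeasurableSpace B]
    [MeasurableSpace C] (μ : Measure A) [SFinite μ] (κ η : Kernel A B) [IsSFiniteKernel κ]
    [IsSFiniteKernel η] {f : A → ENNReal} {g : A → B → ENNReal} {φ : C → ENNReal}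
    {e : A × B → C} (he : Measurable e) (hf : Measurable f) (hφ : Measurable φ)
    [SFinite (μ.withDensity f)]
    (hκ : ∀ a, κ a = (η a).withDensity (g a)) (hg : ∀ a, Measurable (g a))
    (h : ∀ a b, φ (e (a, b)) = f a * g a b) :
    (μ.withDensity f ⊗ₘ κ).map e = ((μ ⊗ₘ η).map e).withDensity φ := by
  ext s hs
  have hm : Measurable fun p => s.indicator φ (e p) := (hφ.indicator hs).comp he
  rw [map_apply he hs, compProd_apply (he hs), withDensity_apply _ hs, ← lintegral_indicator hs,
    lintegral_map (hφ.indicator hs) he, lintegral_compProd hm,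
    lintegral_withDensity_eq_lintegral_mul _ hf (Kernel.measurable_kernel_prodMk_left (he hs))]
  refine lintegral_congr fun a => ?_
  have hm : MeasurableSet (Prod.mk a ⁻¹' (e ⁻¹' s)) := measurable_prodMk_left (he hs)
  rw [Pi.mul_apply, hκ, withDensity_apply _ hm, ← lintegral_indicator hm,
    ← lintegral_const_mul _ ((hg a).indicator hm)]
  refine lintegral_congr fun b => ?_
  by_cases hb : e (a, b) ∈ s
  · rw [Set.indicator_of_mem (by exact hb), Set.indicator_of_mem hb, h]
  · rw [Set.indicator_of_notMem (by exact hb), Set.indicator_of_notMem hb, mul_zero]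

end MeasureTheory.Measure

/-! ### Factorisation of transcript densities over users -/

namespace LocalProtocol

variable {n k : ℕ} {Y : Type*} [MeasurableSpace Y]

/-- The kernel that follows `κ o` when the speaker is `o`. -/
noncomputable def speakerKernel (P : LocalProtocol n k Y) (t : ℕ)
    (κ : Option (Fin n) → Kernel (Fin t → Y) Y) : Kernel (Fin t → Y) Y where
  toFun h := κ (P.speaker t h) h
  measurable' := by
    let _ : MeasurableSpace (Option (Fin n)) := ⊤
    have hs : Measurable (P.speaker t) :=
      measurable_to_countable' fun o => P.measurableSet_speaker t o
    have hg : Measurable fun q : Option (Fin n) × (Fin t → Y) => (κ q.1 q.2 : Measure Y) :=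
      measurable_from_prod_countable_right fun o => (κ o).measurable
    exact hg.comp (hs.prodMk measurable_id)

instance isMarkovKernel_step (P : LocalProtocol n k Y) (x : Fin n → Fin k) (t : ℕ) :
    IsMarkovKernel (P.step x t) := by
  refine ⟨fun h => ?_⟩
  have hs := P.isMarkovKernel_server t
  have hu := fun i a => P.isMarkovKernel_user i t a
  change IsProbabilityMeasure (match P.speaker t h with
    | none => P.server t h
    | some i => P.user i t (x i) h)
  cases P.speaker t h with
  | none => exact hs.isProbabilityMeasure h
  | some i => exact (hu i (x i)).isProbabilityMeasure h

theorem measurable_snoc (t : ℕ) :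
    Measurable fun q : (Fin t → Y) × Y => (Fin.snoc q.1 q.2 : Fin (t + 1) → Y) := by
  refine measurable_pi_lambda _ fun i => ?_
  refine Fin.lastCases ?_ (fun j => ?_) i
  · simpa using measurable_snd
  · simpa [Function.comp_def] using (measurable_pi_apply j).comp (measurable_fst (β := Y))

instance isProbabilityMeasure_prefixLaw (P : LocalProtocol n k Y) (x : Fin n → Fin k) (t : ℕ) :
    IsProbabilityMeasure (P.prefixLaw x t) := by
  induction t with
  | zero => rw [prefixLaw]; infer_instance
  | succ t ih =>
    rw [prefixLaw]
    exact Measure.isProbabilityMeasure_map (measurable_snoc t).aemeasurable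

/-- Given the past, the law of the next message has a density that is a product of functions of the
samples of the single users. -/
theorem exists_step_density [StandardBorelSpace Y] (P : LocalProtocol n k Y) (t : ℕ) :
    ∃ (η : Kernel (Fin t → Y) Y) (D : Fin n → Fin k → (Fin t → Y) → Y → ENNReal),
      IsFiniteKernel η ∧ (∀ i a, Measurable (Function.uncurry (D i a))) ∧
      ∀ x h, P.step x t h = (η h).withDensity fun y => ∏ i, D i (x i) h y := by
  classical
  have hserver := P.isMarkovKernel_server t
  have huser := fun i a => P.isMarkovKernel_user i t a
  -- The sum over the finite alphabet dominates the message law of every sample.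
  let υ : Fin n → Kernel (Fin t → Y) Y := fun i => Kernel.sum fun a => P.user i t a
  have hυ : ∀ i, IsFiniteKernel (υ i) := fun i => by
    refine ⟨⟨k, ENNReal.natCast_lt_top k, fun h => ?_⟩⟩
    simp [υ]
  let κ : Option (Fin n) → Kernel (Fin t → Y) Y := fun o => o.elim (P.server t) υ
  have hac : ∀ i a h, P.user i t a h ≪ υ i h := fun i a h => by
    rw [Kernel.sum_apply]
    exact Measure.absolutelyContinuous_sum_right a .rfl
  -- Silent users get factor 1, so the product over all users reduces to the speaker's factor.
  refine ⟨P.speakerKernel t κ, fun i a h y => if P.speaker t h = some i then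
    (P.user i t a).rnDeriv (υ i) h y else 1, ?_, fun i a => ?_, fun x h => ?_⟩
  · refine ⟨⟨k + 1, by finiteness, fun h => ?_⟩⟩
    change κ (P.speaker t h) h Set.univ ≤ _
    cases P.speaker t h with
    | none => simp [κ]
    | some i => simp [κ, υ]
  · exact Measurable.ite (measurable_fst (P.measurableSet_speaker t (some i)))
      (Kernel.measurable_rnDeriv _ _) measurable_const
  · change (match P.speaker t h with
      | none => P.server t h
      | some i => P.user i t (x i) h) = (κ (P.speaker t h) h).withDensity _
    cases hs : P.speaker t h with
    | none => simp [κ, hs]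
    | some i =>
      simp only [hs, Option.some.injEq, Finset.prod_ite_eq, Finset.mem_univ, if_true]
      exact (Kernel.withDensity_rnDeriv_eq (hac i (x i) h)).symm.trans
        (Kernel.withDensity_apply _ (Kernel.measurable_rnDeriv _ _) _)

/-- The rectangle property: the law of the first messages has a density that is a product of
functions of the samples of the single users. -/
theorem exists_prefixLaw_density [StandardBorelSpace Y] (P : LocalProtocol n k Y) (t : ℕ) :
    ∃ (μ : Measure (Fin t → Y)) (F : Fin n → Fin k → (Fin t → Y) → ENNReal),
      IsFiniteMeasure μ ∧ (∀ i a, Measurable (F i a)) ∧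
      ∀ x, P.prefixLaw x t = μ.withDensity fun h => ∏ i, F i (x i) h := by
  induction t with
  | zero =>
    exact ⟨Measure.dirac Fin.elim0, fun _ _ _ => 1, inferInstance, fun _ _ => measurable_const,
      fun x => by simp [prefixLaw]⟩
  | succ t ih =>
    obtain ⟨μ, F, hμ, hF, hlaw⟩ := ih
    obtain ⟨η, D, hη, hD, hstep⟩ := P.exists_step_density t
    have hinit : Measurable fun h : Fin (t + 1) → Y => (Fin.init h : Fin t → Y) :=
      measurable_pi_lambda _ fun j => measurable_pi_apply j.castSucc
    have hG : ∀ i a, Measurable fun h : Fin (t + 1) → Y =>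
        F i a (Fin.init h) * D i a (Fin.init h) (h (Fin.last t)) := fun i a =>
      ((hF i a).comp hinit).mul ((hD i a).comp (hinit.prodMk (measurable_pi_apply _)))
    refine ⟨(μ ⊗ₘ η).map fun q => (Fin.snoc q.1 q.2 : Fin (t + 1) → Y),
      fun i a h => F i a (Fin.init h) * D i a (Fin.init h) (h (Fin.last t)), inferInstance, hG,
      fun x => ?_⟩
    have hsf : SFinite (μ.withDensity fun h => ∏ i, F i (x i) h) := by
      rw [← hlaw x]; infer_instance
    rw [prefixLaw, hlaw x]
    refine Measure.map_withDensity_compProd μ (P.step x t) η (measurable_snoc t)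
      (Finset.measurable_prod _ fun i _ => hF i (x i))
      (Finset.measurable_prod _ fun i _ => hG i (x i)) (hstep x)
      (fun h => Finset.measurable_prod _ fun i _ => (hD i (x i)).of_uncurry_left) fun h y => ?_
    simp [Finset.prod_mul_distrib]

end LocalProtocol

/-! ### Privacy as a bound on individual likelihood ratios -/

/-- If a product of functions of single coordinates changes by at most a factor `E` when one
coordinate changes, then so does every factor. -/
theorem le_mul_of_prod_le_mul_prod_update {ι A : Type*} [Fintype ι] [DecidableEq ι]
    {f : ι → A → ENNReal} {E : ENNReal}
    (hf : ∀ x i a, ∏ j, f j (x j) ≤ E * ∏ j, f j (Function.update x i a j))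
    {x : ι → A} (h0 : ∏ j, f j (x j) ≠ 0) (htop : ∏ j, f j (x j) ≠ ⊤) (i : ι) (a b : A) :
    f i a ≤ E * f i b := by
  have hne0 : ∀ j, f j (x j) ≠ 0 := fun j => Finset.prod_ne_zero_iff.1 h0 j (Finset.mem_univ j)
  set C := ∏ j ∈ Finset.univ.erase i, f j (x j) with hC
  have hupd : ∀ c, ∏ j, f j (Function.update x i c j) = f i c * C := fun c => by
    rw [← Finset.mul_prod_erase _ _ (Finset.mem_univ i), Function.update_self]
    congr 1
    exact Finset.prod_congr rfl fun j hj => by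
      rw [Function.update_of_ne (Finset.ne_of_mem_erase hj)]
  have hC0 : C ≠ 0 := Finset.prod_ne_zero_iff.2 fun j _ => hne0 j
  have hCtop : C ≠ ⊤ := fun h => htop <| by
    rw [← Finset.mul_prod_erase _ _ (Finset.mem_univ i), ← hC, h, ENNReal.mul_top (hne0 i)]
  have h := hf (Function.update x i a) i b
  rw [Function.update_idem, hupd, hupd, ← mul_assoc] at h
  exact (ENNReal.mul_le_mul_iff_left hC0 hCtop).1 h

namespace LocalProtocol

variable {n k : ℕ} {Y : Type*} [MeasurableSpace Y]

/-- The likelihood ratios of the transcripts of an `(α, 0)`-locally differentially private protocol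
are products of bounded functions of the samples of the single users. -/
theorem IsLDP.exists_likelihoodRatio [StandardBorelSpace Y] {P : LocalProtocol n k Y} {α : ℝ}
    (hP : P.IsLDP α 0) (hα : 0 ≤ α) (a₀ : Fin k) :
    ∃ ρ : Fin n → Fin k → (Fin P.rounds → Y) → ℝ, (∀ i a, Measurable (ρ i a)) ∧
      (∀ i a h, Real.exp (-α) ≤ ρ i a h) ∧ (∀ i a h, ρ i a h ≤ Real.exp α) ∧
      (∀ i h, ρ i a₀ h = 1) ∧
      ∀ x, P.transcriptLaw x = (P.transcriptLaw fun _ => a₀).withDensity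
        fun h => ENNReal.ofReal (∏ i, ρ i (x i) h) := by
  obtain ⟨μ, F, hμ, hF, hlaw⟩ := P.exists_prefixLaw_density P.rounds
  change ∀ x, P.transcriptLaw x = _ at hlaw
  have hFx : ∀ x : Fin n → Fin k, Measurable fun h => ∏ i, F i (x i) h := fun x =>
    Finset.measurable_prod _ fun i _ => hF i (x i)
  set E := ENNReal.ofReal (Real.exp α)
  have hEtop : E ≠ ⊤ := ENNReal.ofReal_ne_top
  -- Clamping makes the bounds hold everywhere; almost everywhere it is inactive where the density
  -- at `a₀` is nonzero.
  let ρ : Fin n → Fin k → (Fin P.rounds → Y) → ℝ := fun i a h => if a = a₀ then 1 else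
    max (Real.exp (-α)) (min (Real.exp α) (F i a h / F i a₀ h).toReal)
  have hρ : ∀ i a, Measurable (ρ i a) := fun i a => by
    by_cases ha : a = a₀
    · simp [ρ, ha]
    · simp only [ρ, ha, if_false]
      exact measurable_const.max (measurable_const.min ((hF i a).div (hF i a₀)).ennreal_toReal)
  have hlow : ∀ i a h, Real.exp (-α) ≤ ρ i a h := fun i a h => by
    by_cases ha : a = a₀
    · simp [ρ, ha, hα]
    · simp [ρ, ha]
  have hle : Real.exp (-α) ≤ Real.exp α := Real.exp_le_exp.2 (by linarith)
  have hup : ∀ i a h, ρ i a h ≤ Real.exp α := fun i a h => by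
    by_cases ha : a = a₀
    · simp [ρ, ha, hα]
    · simpa [ρ, ha] using hle
  refine ⟨ρ, hρ, hlow, hup, fun i h => if_pos rfl, fun x => ?_⟩
  have hldp : ∀ᵐ h ∂μ, ∀ (x : Fin n → Fin k) (i : Fin n) (a : Fin k),
      ∏ j, F j (x j) h ≤ E * ∏ j, F j (Function.update x i a j) h := by
    simp only [ae_all_iff]
    intro x i a
    refine ae_le_of_forall_setLIntegral_le_of_sigmaFinite (hFx x) fun s hs _ => ?_
    rw [lintegral_const_mul _ (hFx _), ← withDensity_apply _ hs, ← withDensity_apply _ hs,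
      ← hlaw, ← hlaw]
    simpa using hP x i a s hs
  have htop : ∀ᵐ h ∂μ, ∏ i, F i a₀ h < ⊤ := by
    refine ae_lt_top (hFx fun _ => a₀) ?_
    have h1 := hlaw fun _ => a₀
    rw [← setLIntegral_univ, ← withDensity_apply _ MeasurableSet.univ, ← h1]
    have := P.isProbabilityMeasure_prefixLaw (fun _ => a₀) P.rounds
    exact measure_ne_top (P.prefixLaw (fun _ => a₀) P.rounds) _
  have hρx : Measurable fun h => ENNReal.ofReal (∏ i, ρ i (x i) h) :=
    ENNReal.measurable_ofReal.comp (Finset.measurable_prod _ fun i _ => hρ i (x i))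
  rw [hlaw x, hlaw fun _ => a₀, ← withDensity_mul _ (hFx fun _ => a₀) hρx]
  refine withDensity_congr_ae ?_
  filter_upwards [hldp, htop] with h hle htop
  rw [Pi.mul_apply, ENNReal.ofReal_prod_of_nonneg fun i _ => (Real.exp_pos _).le.trans (hlow i _ h),
    ← Finset.prod_mul_distrib]
  -- If some `F i a₀ h` vanishes, resetting sample `i` to `a₀` gives density zero, and privacy then
  -- forces the density at `x` to vanish.
  by_cases h0 : ∏ i, F i a₀ h = 0
  · obtain ⟨i, -, hi⟩ := Finset.prod_eq_zero_iff.1 h0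
    rw [Finset.prod_eq_zero (f := fun j => F j a₀ h * ENNReal.ofReal (ρ j (x j) h))
      (Finset.mem_univ i) (by rw [hi, zero_mul])]
    have h1 : ∏ j, F j (Function.update x i a₀ j) h = 0 :=
      Finset.prod_eq_zero (Finset.mem_univ i) (by rw [Function.update_self, hi])
    simpa [h1] using hle x i a₀
  · refine Finset.prod_congr rfl fun i _ => ?_
    have hbd := le_mul_of_prod_le_mul_prod_update (f := fun i a => F i a h) hle
      (x := fun _ => a₀) h0 htop.ne i
    have hi0 : F i a₀ h ≠ 0 := Finset.prod_ne_zero_iff.1 h0 i (Finset.mem_univ i)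
    have hitop : F i a₀ h ≠ ⊤ := fun hi => htop.ne <| by
      rw [← Finset.mul_prod_erase _ _ (Finset.mem_univ i), hi, ENNReal.top_mul]
      exact Finset.prod_ne_zero_iff.2 fun j _ =>
        Finset.prod_ne_zero_iff.1 h0 j (Finset.mem_univ j)
    by_cases ha : x i = a₀
    · simp [ρ, ha]
    · have h1 : F i (x i) h / F i a₀ h ≤ E := ENNReal.div_le_of_le_mul (hbd _ _)
      have hdtop : F i (x i) h / F i a₀ h ≠ ⊤ := ne_top_of_le_ne_top hEtop h1
      have h2 : E⁻¹ ≤ F i (x i) h / F i a₀ h := by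
        rw [ENNReal.le_div_iff_mul_le (.inl hi0) (.inl hitop), mul_comm, ← div_eq_mul_inv]
        exact ENNReal.div_le_of_le_mul (mul_comm E _ ▸ hbd _ _)
      have h3 : (F i (x i) h / F i a₀ h).toReal ≤ Real.exp α :=
        ENNReal.toReal_le_of_le_ofReal (Real.exp_pos α).le h1
      have h4 : Real.exp (-α) ≤ (F i (x i) h / F i a₀ h).toReal := by
        rw [Real.exp_neg, ← ENNReal.ofReal_le_iff_le_toReal hdtop,
          ENNReal.ofReal_inv_of_pos (Real.exp_pos α)]
        exact h2
      have h5 : ρ i (x i) h = (F i (x i) h / F i a₀ h).toReal := by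
        simp only [ρ, ha, if_false]
        rw [min_eq_right h3, max_eq_right h4]
      rw [h5, ENNReal.ofReal_toReal hdtop, ENNReal.mul_div_cancel hi0 hitop]

end LocalProtocol

/-! ### Affinity from divergence -/

/-- Applying `log s ≤ s - 1` at `s = √R` gives `(1 - √R)² ≤ R - 1 - log R`, and `1 + √R ≤ 2`. -/
theorem one_sub_sq_le_four_mul {R : ℝ} (h0 : 0 < R) (h1 : R ≤ 1) :
    (1 - R) ^ 2 ≤ 4 * (R - 1 - Real.log R) := by
  have hs := Real.sqrt_pos.2 h0
  have hsq := Real.sq_sqrt h0.le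
  have hs1 : √R ≤ 1 := Real.sqrt_le_one.2 h1
  have hlog := Real.log_le_sub_one_of_pos hs
  rw [Real.log_sqrt h0.le] at hlog
  have : (1 - R) ^ 2 ≤ 4 * (1 - √R) ^ 2 := by
    have h : (1 - R) ^ 2 = (1 + √R) ^ 2 * (1 - √R) ^ 2 := by rw [← hsq]; ring_nf; simp [hsq]
    rw [h]
    exact mul_le_mul_of_nonneg_right (by nlinarith) (sq_nonneg _)
  nlinarith

/-- A pointwise Pinsker-type bound: for `R ≤ 1`, AM-GM gives `1 - R ≤ η + (1 - R)² / (4η)`. The free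
parameter `η` replaces a square root, so the bound can be integrated directly. -/
theorem one_sub_sub_div_le_min {R η : ℝ} (h0 : 0 < R) (hη : 0 < η) :
    1 - η - (R - 1 - Real.log R) / η ≤ min 1 R := by
  have hD : 0 ≤ (R - 1 - Real.log R) / η :=
    div_nonneg (by linarith [Real.log_le_sub_one_of_pos h0]) hη.le
  refine le_min (by linarith) ?_
  rcases le_total 1 R with h1 | h1
  · linarith
  · have h := one_sub_sq_le_four_mul h0 h1
    have hx : 1 - R - η ≤ (R - 1 - Real.log R) / η := by
      rw [le_div_iff₀ hη]
      nlinarith [sq_nonneg (1 - R - 2 * η)]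
    linarith

theorem sub_one_sub_two_mul_sq_le_log {r : ℝ} (hr : 1 / 2 ≤ r) :
    r - 1 - 2 * (r - 1) ^ 2 ≤ Real.log r := by
  have h0 : 0 < r := by linarith
  refine le_trans ?_ (Real.one_sub_inv_le_log_of_pos h0)
  have h : 1 - r⁻¹ - (r - 1 - 2 * (r - 1) ^ 2) = (r - 1) ^ 2 * (2 * r - 1) / r := by
    field_simp; ring
  have : 0 ≤ (r - 1) ^ 2 * (2 * r - 1) / r :=
    div_nonneg (mul_nonneg (sq_nonneg _) (by linarith)) h0.le
  linarith

/-- If `r i` are likelihood ratios close to `1` and `∏ i, r i` is a likelihood ratio as well, then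
the affinity `∫ min 1 (∏ i, r i)` is close to `1`. -/
theorem le_integral_min_one_prod {Ω ι : Type*} [Fintype ι] [MeasurableSpace Ω] (μ : Measure Ω)
    [IsProbabilityMeasure μ] (r : ι → Ω → ℝ) {δ η : ℝ} (hη : 0 < η)
    (hr : ∀ i ω, 1 / 2 ≤ r i ω) (hδ : ∀ i ω, |r i ω - 1| ≤ δ)
    (hint : ∀ i, Integrable (r i) μ) (hone : ∀ i, ∫ ω, r i ω ∂μ = 1)
    (hint' : Integrable (fun ω => ∏ i, r i ω) μ) (hone' : ∫ ω, ∏ i, r i ω ∂μ = 1) :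
    1 - η - 2 * Fintype.card ι * δ ^ 2 / η ≤ ∫ ω, min 1 (∏ i, r i ω) ∂μ := by
  -- The logarithm is replaced by a linear lower bound, whose integral needs only the means of the
  -- `r i`.
  have hpt : ∀ ω, 1 - η - (∏ i, r i ω - 1 - (∑ i, (r i ω - 1) - Fintype.card ι * (2 * δ ^ 2))) / η
      ≤ min 1 (∏ i, r i ω) := fun ω => by
    have hpos : ∀ i, 0 < r i ω := fun i => lt_of_lt_of_le (by norm_num) (hr i ω)
    refine le_trans ?_ (one_sub_sub_div_le_min (Finset.prod_pos fun i _ => hpos i) hη)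
    have hlog : ∑ i, (r i ω - 1) - Fintype.card ι * (2 * δ ^ 2) ≤ Real.log (∏ i, r i ω) := by
      rw [Real.log_prod fun i _ => (hpos i).ne']
      have h : ∑ i, (r i ω - 1 - 2 * δ ^ 2) ≤ ∑ i, Real.log (r i ω) :=
        Finset.sum_le_sum fun i _ => by
          have h1 := sub_one_sub_two_mul_sq_le_log (hr i ω)
          have h2 : (r i ω - 1) ^ 2 ≤ δ ^ 2 := sq_le_sq' (abs_le.1 (hδ i ω)).1 (abs_le.1 (hδ i ω)).2
          linarith
      simpa [Finset.sum_sub_distrib] using h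
    gcongr
  have hI1 : Integrable (fun ω => ∑ i, (r i ω - 1)) μ :=
    integrable_finsetSum _ fun i _ => (hint i).sub (integrable_const _)
  have hI2 : Integrable (fun ω => ∑ i, (r i ω - 1) - Fintype.card ι * (2 * δ ^ 2)) μ :=
    hI1.sub (integrable_const _)
  have hI3 : Integrable (fun ω => ∏ i, r i ω - 1) μ := hint'.sub (integrable_const _)
  have hsum : ∫ ω, ∑ i, (r i ω - 1) ∂μ = 0 := by
    rw [integral_finsetSum (f := fun i ω => r i ω - 1) _
      fun i _ => (hint i).sub (integrable_const _)]
    refine Finset.sum_eq_zero fun i _ => ?_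
    rw [integral_sub (hint i) (integrable_const _), hone i]
    simp
  have hI4 : Integrable (fun ω => (∏ i, r i ω - 1 -
      (∑ i, (r i ω - 1) - Fintype.card ι * (2 * δ ^ 2))) / η) μ := (hI3.sub hI2).div_const η
  have hval : ∫ ω, 1 - η - (∏ i, r i ω - 1 -
      (∑ i, (r i ω - 1) - Fintype.card ι * (2 * δ ^ 2))) / η ∂μ
      = 1 - η - 2 * Fintype.card ι * δ ^ 2 / η := by
    rw [integral_sub (integrable_const _) hI4, integral_div,
      integral_sub hI3 hI2, integral_sub hint' (integrable_const _),
      integral_sub hI1 (integrable_const _), hsum, hone']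
    simp
    ring
  rw [← hval]
  exact integral_mono ((integrable_const _).sub hI4)
    ((integrable_const _).inf hint') hpt

/-! ### The two-point bound for private protocols -/

namespace LocalProtocol

variable {n k : ℕ} {Y : Type*} [MeasurableSpace Y]

instance isProbabilityMeasure_transcriptLaw (P : LocalProtocol n k Y) (x : Fin n → Fin k) :
    IsProbabilityMeasure (P.transcriptLaw x) :=
  P.isProbabilityMeasure_prefixLaw x P.rounds

/-- If `q` is close to the point mass at `a₀`, then the transcripts of a locally private protocol
under the two distributions are hard to tell apart. -/
theorem IsLDP.exists_mixtureRatio [StandardBorelSpace Y] {P : LocalProtocol n k Y} {α : ℝ}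
    (hP : P.IsLDP α 0) (hα : 0 ≤ α) (hα' : α ≤ Real.log 2) (a₀ : Fin k) {q : Fin k → ℝ}
    (hq : q ∈ stdSimplex ℝ (Fin k)) {η : ℝ} (hη : 0 < η) :
    ∃ R : (Fin P.rounds → Y) → ℝ, Measurable R ∧ (∀ h, 0 ≤ R h) ∧
      (∀ g : (Fin P.rounds → Y) → ENNReal, Measurable g →
        ∑ x : Fin n → Fin k, ENNReal.ofReal (∏ i, q (x i)) * ∫⁻ h, g h ∂(P.transcriptLaw x) =
          ∫⁻ h, ENNReal.ofReal (R h) * g h ∂(P.transcriptLaw fun _ => a₀)) ∧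
      1 - η - 2 * n * ((1 - q a₀) * (Real.exp α - 1)) ^ 2 / η ≤
        ∫ h, min 1 (R h) ∂(P.transcriptLaw fun _ => a₀) := by
  obtain ⟨ρ, hρ, hlow, hup, hone, hlaw⟩ := hP.exists_likelihoodRatio hα a₀
  set μ := P.transcriptLaw fun _ => a₀ with hμ
  have hρ0 : ∀ i a h, 0 ≤ ρ i a h := fun i a h => (Real.exp_pos _).le.trans (hlow i a h)
  have hρx : ∀ x : Fin n → Fin k, Measurable fun h => ∏ i, ρ i (x i) h := fun x =>
    Finset.measurable_prod _ fun i _ => hρ i (x i)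
  have hρx0 : ∀ (x : Fin n → Fin k) h, 0 ≤ ∏ i, ρ i (x i) h := fun x h =>
    Finset.prod_nonneg fun i _ => hρ0 i _ h
  have hq0 : ∀ x : Fin n → Fin k, 0 ≤ ∏ i, q (x i) := fun x => Finset.prod_nonneg fun i _ => hq.1 _
  have hxint : ∀ x : Fin n → Fin k, Integrable (fun h => ∏ i, ρ i (x i) h) μ := fun x =>
    Integrable.of_bound (hρx x).aestronglyMeasurable (Real.exp α ^ n) (.of_forall fun h => by
      rw [Real.norm_of_nonneg (hρx0 x h)]
      simpa using Finset.prod_le_prod (fun i (_ : i ∈ Finset.univ) => hρ0 i (x i) h)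
        fun i _ => hup i (x i) h)
  have hxone : ∀ x : Fin n → Fin k, ∫ h, ∏ i, ρ i (x i) h ∂μ = 1 := fun x => by
    rw [integral_eq_lintegral_of_nonneg_ae (.of_forall (hρx0 x)) (hxint x).1,
      ← setLIntegral_univ, ← withDensity_apply _ MeasurableSet.univ, ← hlaw x]
    simp
  have hρint : ∀ i a, Integrable (ρ i a) μ := fun i a =>
    Integrable.of_bound (hρ i a).aestronglyMeasurable (Real.exp α) (.of_forall fun h => by
      rw [Real.norm_of_nonneg (hρ0 i a h)]
      exact hup i a h)
  -- With every other sample at `a₀`, the full likelihood ratio is `ρ i a` alone.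
  have hρone : ∀ i a, ∫ h, ρ i a h ∂μ = 1 := fun i a => by
    rw [← hxone (Function.update (fun _ => a₀) i a)]
    refine integral_congr_ae (.of_forall fun h => ?_)
    change ρ i a h = ∏ j, ρ j (Function.update (fun _ => a₀) i a j) h
    rw [Finset.prod_eq_single i (fun j _ hj => by rw [Function.update_of_ne hj, hone])
      (fun hi => absurd (Finset.mem_univ i) hi), Function.update_self]
  let r : Fin n → (Fin P.rounds → Y) → ℝ := fun i h => ∑ a, q a * ρ i a h
  have hprod : ∀ h, ∏ i, r i h = ∑ x : Fin n → Fin k, (∏ i, q (x i)) * ∏ i, ρ i (x i) h :=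
    fun h => by
      simp only [r, ← Finset.prod_mul_distrib]
      rw [Finset.prod_univ_sum, Fintype.piFinset_univ]
  have hrint : ∀ i, Integrable (r i) μ := fun i =>
    integrable_finsetSum _ fun a _ => (hρint i a).const_mul _
  have hrone : ∀ i, ∫ h, r i h ∂μ = 1 := fun i => by
    rw [integral_finsetSum _ fun a _ => (hρint i a).const_mul _]
    simp [integral_const_mul, hρone, hq.2]
  have hpint : Integrable (fun h => ∏ i, r i h) μ := by
    simp only [hprod]
    exact integrable_finsetSum _ fun x _ => (hxint x).const_mul _
  have hpone : ∫ h, ∏ i, r i h ∂μ = 1 := by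
    simp only [hprod]
    rw [integral_finsetSum _ fun x _ => (hxint x).const_mul _]
    simp only [integral_const_mul, hxone, mul_one]
    have h := Finset.prod_univ_sum (fun _ : Fin n => Finset.univ) fun _ a => q a
    rw [Fintype.piFinset_univ] at h
    rw [← h]
    simp [hq.2]
  have hr0 : ∀ i h, 0 ≤ r i h := fun i h =>
    Finset.sum_nonneg fun a _ => mul_nonneg (hq.1 a) (hρ0 i a h)
  have hhalf : 1 / 2 ≤ Real.exp (-α) := by
    rw [Real.exp_neg, one_div]
    exact inv_anti₀ (Real.exp_pos α) ((Real.le_log_iff_exp_le two_pos).1 hα')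
  have hrhalf : ∀ i h, 1 / 2 ≤ r i h := fun i h => by
    calc (1 / 2 : ℝ) = ∑ a, q a * (1 / 2) := by rw [← Finset.sum_mul, hq.2, one_mul]
      _ ≤ r i h := Finset.sum_le_sum fun a _ =>
        mul_le_mul_of_nonneg_left (hhalf.trans (hlow i a h)) (hq.1 a)
  have hρ1 : ∀ i a h, |ρ i a h - 1| ≤ Real.exp α - 1 := fun i a h => by
    refine abs_le.2 ⟨?_, by linarith [hup i a h]⟩
    linarith [hlow i a h, Real.add_one_le_exp α, Real.add_one_le_exp (-α)]
  -- The term at `a₀` drops out since `ρ i a₀ = 1`; only the mass off `a₀` contributes.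
  have hrone' : ∀ i h, |r i h - 1| ≤ (1 - q a₀) * (Real.exp α - 1) := fun i h => by
    have h1 : r i h - 1 = ∑ a ∈ Finset.univ.erase a₀, q a * (ρ i a h - 1) := by
      have h2 : r i h - 1 = ∑ a, q a * (ρ i a h - 1) := by
        simp [r, mul_sub, Finset.sum_sub_distrib, hq.2]
      rw [h2, ← Finset.add_sum_erase _ _ (Finset.mem_univ a₀), hone]
      simp
    have h3 : ∑ a ∈ Finset.univ.erase a₀, q a = 1 - q a₀ := by
      rw [← hq.2, ← Finset.add_sum_erase _ _ (Finset.mem_univ a₀)]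
      ring
    rw [h1, ← h3, Finset.sum_mul]
    refine (Finset.abs_sum_le_sum_abs _ _).trans (Finset.sum_le_sum fun a _ => ?_)
    rw [abs_mul, abs_of_nonneg (hq.1 a)]
    exact mul_le_mul_of_nonneg_left (hρ1 i a h) (hq.1 a)
  refine ⟨fun h => ∏ i, r i h, Finset.measurable_prod _ fun i _ =>
    Finset.measurable_sum _ fun a _ => (hρ i a).const_mul _,
    fun h => Finset.prod_nonneg fun i _ => hr0 i h, fun g hg => ?_, ?_⟩
  · calc _ = ∑ x : Fin n → Fin k, ∫⁻ h, ENNReal.ofReal (∏ i, q (x i)) *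
          (ENNReal.ofReal (∏ i, ρ i (x i) h) * g h) ∂μ := by
          refine Finset.sum_congr rfl fun x _ => ?_
          rw [hlaw x, lintegral_withDensity_eq_lintegral_mul _ (hρx x).ennreal_ofReal hg,
            ← lintegral_const_mul _ ((hρx x).ennreal_ofReal.mul hg)]
          rfl
      _ = ∫⁻ h, ∑ x : Fin n → Fin k, ENNReal.ofReal (∏ i, q (x i)) *
          (ENNReal.ofReal (∏ i, ρ i (x i) h) * g h) ∂μ :=
        (lintegral_finsetSum _ fun x _ => ((hρx x).ennreal_ofReal.mul hg).const_mul _).symm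
      _ = _ := by
        refine lintegral_congr fun h => ?_
        beta_reduce
        rw [hprod, ENNReal.ofReal_sum_of_nonneg fun x _ => mul_nonneg (hq0 x) (hρx0 x h),
          Finset.sum_mul]
        refine Finset.sum_congr rfl fun x _ => ?_
        rw [ENNReal.ofReal_mul (hq0 x), mul_assoc]
  · simpa using le_integral_min_one_prod μ r hη hrhalf hrone' hrint hrone hpint hpone

/-- Le Cam's two-point bound for a point mass and a nearby distribution. -/
theorem IsLDP.le_expectedError_add_expectedError [StandardBorelSpace Y] {P : LocalProtocol n k Y}
    {α : ℝ} (hP : P.IsLDP α 0) (hα : 0 ≤ α) (hα' : α ≤ Real.log 2) (a₀ : Fin k) {q : Fin k → ℝ}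
    (hq : q ∈ stdSimplex ℝ (Fin k)) {η : ℝ} (hη : 0 < η) {est : (Fin P.rounds → Y) → ℝ}
    (hest : Measurable est) :
    ENNReal.ofReal (|collisionProb (Pi.single a₀ 1) - collisionProb q| *
        (1 - η - 2 * n * ((1 - q a₀) * (Real.exp α - 1)) ^ 2 / η)) ≤
      expectedError P est (Pi.single a₀ 1) + expectedError P est q := by
  obtain ⟨R, hR, hR0, hsum, hint⟩ := hP.exists_mixtureRatio hα hα' a₀ hq hη
  set μ := P.transcriptLaw fun _ => a₀ with hμ
  set A := collisionProb (Pi.single a₀ 1 : Fin k → ℝ) with hA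
  set B := collisionProb q with hB
  have hmeas : ∀ c : ℝ, Measurable fun h => ENNReal.ofReal |est h - c| := fun c =>
    (hest.sub_const c).norm.ennreal_ofReal
  have hp : ∫⁻ h, ENNReal.ofReal |est h - A| ∂μ ≤ expectedError P est (Pi.single a₀ 1) := by
    refine le_trans ?_ (Finset.single_le_sum (fun _ _ => zero_le) (Finset.mem_univ fun _ => a₀))
    simp [hA, hμ]
  have hqq : expectedError P est q = ∫⁻ h, ENNReal.ofReal (R h) * ENNReal.ofReal |est h - B| ∂μ :=
    hsum _ (hmeas B)
  have hmin : Integrable (fun h => |A - B| * min 1 (R h)) μ :=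
    (Integrable.of_bound (measurable_const.min hR).aestronglyMeasurable 1 (.of_forall fun h => by
      rw [Real.norm_of_nonneg (le_min zero_le_one (hR0 h))]
      exact min_le_left _ _)).const_mul _
  calc _ ≤ ENNReal.ofReal (∫ h, |A - B| * min 1 (R h) ∂μ) := by
        rw [integral_const_mul]
        exact ENNReal.ofReal_le_ofReal (mul_le_mul_of_nonneg_left hint (abs_nonneg _))
    _ = ∫⁻ h, ENNReal.ofReal (|A - B| * min 1 (R h)) ∂μ :=
        ofReal_integral_eq_lintegral_ofReal hmin (.of_forall fun h =>
          mul_nonneg (abs_nonneg _) (le_min zero_le_one (hR0 h)))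
    _ ≤ ∫⁻ h, (ENNReal.ofReal |est h - A| +
          ENNReal.ofReal (R h) * ENNReal.ofReal |est h - B|) ∂μ := by
        refine lintegral_mono fun h => ?_
        change ENNReal.ofReal _ ≤ _
        rw [← ENNReal.ofReal_mul (hR0 h),
          ← ENNReal.ofReal_add (abs_nonneg _) (mul_nonneg (hR0 h) (abs_nonneg _))]
        refine ENNReal.ofReal_le_ofReal ?_
        have h1 : |A - B| ≤ |est h - A| + |est h - B| := by
          rw [abs_sub_comm (est h) A]
          exact abs_sub_le _ _ _
        have hm0 : 0 ≤ min 1 (R h) := le_min zero_le_one (hR0 h)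
        nlinarith [mul_le_mul_of_nonneg_right h1 hm0,
          mul_le_mul_of_nonneg_left (min_le_left 1 (R h)) (abs_nonneg (est h - A)),
          mul_le_mul_of_nonneg_left (min_le_right 1 (R h)) (abs_nonneg (est h - B))]
    _ = ∫⁻ h, ENNReal.ofReal |est h - A| ∂μ + expectedError P est q := by
        rw [lintegral_add_left (hmeas A), hqq]
    _ ≤ _ := by gcongr

end LocalProtocol

/-! ### The hard pair and the choice of constants -/

theorem collisionProb_single {k : ℕ} (a₀ : Fin k) :
    collisionProb (Pi.single a₀ 1 : Fin k → ℝ) = 1 := by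
  rw [collisionProb, Finset.sum_eq_single a₀ (fun a _ ha => by simp [ha]) (by simp)]
  simp

/-- Every collision probability `1 - γ` is attained by a distribution that is within `γ` of the
point mass at `a₀` in total variation. -/
theorem exists_collisionProb_eq {k : ℕ} (hk : 2 ≤ k) (a₀ : Fin k) {γ : ℝ} (h0 : 0 ≤ γ)
    (h1 : γ ≤ 1 - 1 / (k : ℝ)) :
    ∃ q ∈ stdSimplex ℝ (Fin k), collisionProb q = 1 - γ ∧ 0 ≤ 1 - q a₀ ∧ 1 - q a₀ ≤ γ := by
  have hk0 : (0 : ℝ) < k := by positivity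
  have hk2 : (2 : ℝ) ≤ k := by exact_mod_cast hk
  set K : ℝ := 1 - 1 / k with hK
  have hK0 : 0 < K := by
    have : 1 / (k : ℝ) ≤ 1 / 2 := one_div_le_one_div_of_le two_pos hk2
    linarith
  have hγ : γ / K ≤ 1 := (div_le_one hK0).2 h1
  -- With weight `l` on the point mass and `1 - l` on the uniform law, one minus the collision
  -- probability is `(1 - l²) K`, while the mass off `a₀` is `(1 - l) K`, which is no larger.
  set l : ℝ := √(1 - γ / K) with hl
  have hl0 : 0 ≤ l := Real.sqrt_nonneg _
  have hlsq : l ^ 2 = 1 - γ / K := Real.sq_sqrt (by linarith)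
  have hl1 : l ≤ 1 := Real.sqrt_le_one.2 (by linarith [div_nonneg h0 hK0.le])
  have hlγ : (1 - l ^ 2) * K = γ := by
    rw [hlsq]
    field_simp
    ring
  have hq : 1 - (l + (1 - l) / k) = (1 - l) * K := by rw [hK]; ring
  refine ⟨fun a => l * (Pi.single a₀ 1 : Fin k → ℝ) a + (1 - l) / k, ⟨fun a => ?_, ?_⟩, ?_, ?_, ?_⟩
  · have h2 : (0 : ℝ) ≤ (Pi.single a₀ 1 : Fin k → ℝ) a := by
      by_cases ha : a = a₀
      · simp [ha]
      · simp [ha]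
    exact add_nonneg (mul_nonneg hl0 h2) (div_nonneg (by linarith) hk0.le)
  · simp only [Finset.sum_add_distrib, ← Finset.mul_sum, Finset.sum_pi_single', Finset.sum_const,
      Finset.card_univ, Fintype.card_fin, nsmul_eq_mul]
    simp
    field_simp
    ring
  · have hs := collisionProb_single a₀
    rw [collisionProb] at hs ⊢
    have hexp : ∀ a, (l * (Pi.single a₀ 1 : Fin k → ℝ) a + (1 - l) / k) ^ 2 =
        l ^ 2 * (Pi.single a₀ 1 : Fin k → ℝ) a ^ 2 +
        2 * l * (1 - l) / k * (Pi.single a₀ 1 : Fin k → ℝ) a + ((1 - l) / k) ^ 2 := fun a => by ring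
    simp only [hexp, Finset.sum_add_distrib, ← Finset.mul_sum, hs]
    rw [← hlγ, hK]
    simp
    field_simp
    ring
  · simp only [Pi.single_eq_same, mul_one, hq]
    exact mul_nonneg (by linarith) hK0.le
  · simp only [Pi.single_eq_same, mul_one, hq]
    rw [← hlγ]
    exact mul_le_mul_of_nonneg_right (by nlinarith) hK0.le

theorem exp_sub_one_le_two_mul {α : ℝ} (h0 : 0 ≤ α) (h1 : α ≤ Real.log 2) :
    Real.exp α - 1 ≤ 2 * α := by
  have h2 : Real.exp α ≤ 2 := (Real.le_log_iff_exp_le two_pos).1 h1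
  have h3 : Real.exp α * Real.exp (-α) = 1 := by rw [← Real.exp_add]; simp
  nlinarith [mul_le_mul_of_nonneg_left (Real.add_one_le_exp (-α)) (Real.exp_pos α).le]

theorem theorem3 (θ : ℝ) (hθ0 : 0 < θ) (hθ1 : θ < 1) :
    ∃ c : ℝ, 0 < c ∧
      ∀ (k n : ℕ) (α ε : ℝ), 2 ≤ k → 0 ≤ α → α ≤ 23 / 35 →
        0 < ε → ε ≤ θ * ((1 - 1 / (k : ℝ)) / 2) →
        (n : ℝ) * (α ^ 2 * ε ^ 2) ≤ c →
        ∀ (Y : Type*) [MeasurableSpace Y] [StandardBorelSpace Y] (P : LocalProtocol n k Y),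
          P.IsLDP α 0 →
          ∀ est : (Fin P.rounds → Y) → ℝ, Measurable est →
            ∃ p ∈ stdSimplex ℝ (Fin k), ENNReal.ofReal ε ≤ expectedError P est p := by
  have hη : 0 < (1 - θ) / 2 := by linarith
  -- With `η = (1 - θ) / 2`, this constant makes the divergence term at most `η²`, so the affinity
  -- is at least `1 - 2η = θ`.
  refine ⟨θ ^ 2 * (1 - θ) ^ 2 / 128, by positivity, ?_⟩
  intro k n α ε hk hα hα1 hε hεk hn Y _ _ P hP est hest
  -- `α ≤ log 2` keeps all ratios at least `1/2`, as the quadratic lower bound on the logarithm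
  -- requires.
  have hlog : α ≤ Real.log 2 := by linarith [Real.log_two_gt_d9]
  let a₀ : Fin k := ⟨0, by omega⟩
  obtain ⟨q, hq, hC, hq0, hq1⟩ := exists_collisionProb_eq hk a₀ (γ := 2 * ε / θ) (by positivity)
    (by rw [div_le_iff₀ hθ0]; linarith)
  by_contra! hcon
  have h1 := hcon (Pi.single a₀ 1) (single_mem_stdSimplex ℝ a₀)
  have h2 := hcon q hq
  have hle := hP.le_expectedError_add_expectedError hα hlog a₀ hq hη hest
  have hlt := hle.trans_lt (ENNReal.add_lt_add h1 h2)
  rw [← ENNReal.ofReal_add hε.le hε.le, collisionProb_single, hC, sub_sub_cancel,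
    abs_of_nonneg (by positivity)] at hlt
  refine hlt.not_ge (ENNReal.ofReal_le_ofReal ?_)
  have hδ : (1 - q a₀) * (Real.exp α - 1) ≤ 2 * ε / θ * (2 * α) :=
    mul_le_mul hq1 (exp_sub_one_le_two_mul hα hlog) (by linarith [Real.add_one_le_exp α])
      (by positivity)
  have hδ0 : 0 ≤ (1 - q a₀) * (Real.exp α - 1) :=
    mul_nonneg hq0 (by linarith [Real.add_one_le_exp α])
  have hδ2 : 2 * n * ((1 - q a₀) * (Real.exp α - 1)) ^ 2 ≤ (1 - θ) ^ 2 / 4 := by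
    calc _ ≤ 2 * n * (2 * ε / θ * (2 * α)) ^ 2 := by gcongr
      _ = 32 / θ ^ 2 * (n * (α ^ 2 * ε ^ 2)) := by field_simp; ring
      _ ≤ 32 / θ ^ 2 * (θ ^ 2 * (1 - θ) ^ 2 / 128) := by gcongr
      _ = _ := by field_simp; ring
  have hdiv : 2 * n * ((1 - q a₀) * (Real.exp α - 1)) ^ 2 / ((1 - θ) / 2) ≤ (1 - θ) / 2 := by
    rw [div_le_iff₀ hη]
    linarith
  calc ε + ε = 2 * ε / θ * θ := by field_simp; ring
    _ ≤ _ := mul_le_mul_of_nonneg_left (by linarith) (by positivity)
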